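/- **Setting.** Let $\vec p=(f_u,f_v,g_u,g_v,k)\in\mathbb R^5$ with $k>0$, where $f_u,f_v,g_u,g_v$ are the partial derivatives of the reaction kinetics $f,g$ at a homogeneous steady state. Put $$A=\frac{f_u+g_v}{1+k},\qquad a,b=\frac{(kf_u+g_v)\mp\sqrt{(kf_u+g_v)^2-4k(f_ug_v-f_vg_u)}}{2k}$$ ($a$ takes the minus sign, $b$ the plus sign), and consider the conditions (1) $f_u+g_v<0$; (2) $f_ug_v-f_vg_u>0$; (3) $(kf_u+g_v)^2-4k(f_ug_v-f_vg_u)>0$; (4) $kf_u+g_v>0$. For $R>0$ and $\tau\in\mathbb R$, the free boundary conditions on $(-R,R)$ are $\phi''=0$ and $\phi'''-\tau\phi'=0$ at $x=\pm R$. **Turing space.** $TS(\vec p)$ is the set of all $(R,\tau)$ with $R>0$ and $\tau\in\mathbb R$ such that * all eigenvalues of the matrix $\begin{pmatrix}f_u&f_v\\ g_u&g_v\end{pmatrix}$ have negative real part (the steady state is linearly asymptotically stable without diffusion), and * the linearized system with diffusion $$u_t=-(u''''-\tau u'')+f_uu+f_vv,\qquad v_t=-k(v''''-\tau v'')+g_uu+g_vv\qquad\text{on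 }(-R,R),$$ with the free boundary conditions on $u$ and on $v$, has a nonzero solution of the form $e^{\lambda t}(u(x),v(x))$ with $u,v\in C^4([-R,R];\mathbb C)$, $\lambda\in\mathbb C$ and $\operatorname{Re}\lambda>0$ (the steady state is linearly unstable with diffusion). **Branches and regions.** Consider the free rod eigenvalue problem $\phi''''-\tau\phi''=\mu\phi$ on $(-1,1)$ with the free boundary conditions at $\pm1$. For $l=0,1,2,\dots$ let $\mu_l^{\rm even}(\tau)$ (respectively $\mu_l^{\rm odd}(\tau)$) be the $(l+1)$-th smallest of the eigenvalues that have a nonconstant even (respectively odd) eigenfunction. For $l\ge 0$ let $$E_-(l)=\{(R,\tau):R>0,\ R^{-4}\mu_l^{\rm even}(\tau R^2)<A,\ \tau<0\},\qquad E_+(l)=\{(R,\tau):R>0,\ R^{-4}\mu_l^{\rm even}(\tau R^2)\in(a,b)\},$$ define $O_\pm(l)$ in the same way with $\mu_l^{\rm odd}$ in place of $\mu_l^{\rm even}$, and put $E(l)=E_+(l)\cup E_-(l)$, $O(l)=O_+(l)\cup O_-(l)$. **Theorem.** 1. If $\vec p$ satisfies (1)–(4), then $TS(\vec p)=\bigcup_{l\ge0}\bigl(E(l)\cup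 O(l)\bigr)$. 2. If $\vec p$ satisfies (1) and (2), then $E_-(l)\cup O_-(l)\subset TS(\vec p)$ for every $l\ge0$. -/

import Mathlib

namespace FreeRodTuring

/-- The vector of reaction-diffusion parameters: the partial derivatives of the
kinetics `f`, `g` at the homogeneous steady state, and the diffusivity `k`. -/
structure Params where
  fu : ℝ
  fv : ℝ
  gu : ℝ
  gv : ℝ
  k : ℝ

/-! ### The operator `φ ↦ φ'''' - τ φ''` on `(-R, R)` with free boundary conditions

Functions of class `C⁴` on the closed interval `[-R, R]` are given as restrictions of `C⁴`
functions on the line; only the values on `[-R, R]` matter below. -/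

/-- The fourth order diffusion operator `Δ² - τ Δ` in one dimension. -/
noncomputable def rodOp {F : Type*} [NormedAddCommGroup F] [NormedSpace ℝ F]
    (τ : ℝ) (φ : ℝ → F) (x : ℝ) : F :=
  iteratedDeriv 4 φ x - τ • iteratedDeriv 2 φ x

/-- The natural (free) boundary conditions at `x` in `{-R, R}`:
`φ'' = 0` and `φ''' - τ φ' = 0`. -/
def FreeBC {F : Type*} [NormedAddCommGroup F] [NormedSpace ℝ F]
    (R τ : ℝ) (φ : ℝ → F) : Prop :=
  ∀ x : ℝ, x = -R ∨ x = R →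
    iteratedDeriv 2 φ x = 0 ∧ iteratedDeriv 3 φ x - τ • iteratedDeriv 1 φ x = 0

/-- `φ` solves the free rod eigenvalue problem on `(-R, R)` with tension `τ` and
spectral parameter `μ` (it may vanish identically on the interval). -/
def SolvesRod (R τ μ : ℝ) (φ : ℝ → ℝ) : Prop :=
  ContDiff ℝ 4 φ ∧ FreeBC R τ φ ∧ ∀ x ∈ Set.Ioo (-R) R, rodOp τ φ x = μ * φ x

/-- `φ` is not constant on `[-R, R]`. -/
def NonconstOn (R : ℝ) (φ : ℝ → ℝ) : Prop :=
  ∃ x ∈ Set.Icc (-R) R, ∃ y ∈ Set.Icc (-R) R, φ x ≠ φ y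

/-- The eigenvalues of the free rod `(-1, 1)` with tension `τ` that have an even nonconstant
eigenfunction. (The constant function is an even eigenfunction with eigenvalue `0` for every
`τ`; this trivial branch is not among the even branches.) -/
def evenEigenvalues (τ : ℝ) : Set ℝ :=
  {μ | ∃ φ : ℝ → ℝ, SolvesRod 1 τ μ φ ∧ NonconstOn 1 φ ∧
    ∀ x ∈ Set.Icc (-1 : ℝ) 1, φ (-x) = φ x}

/-- The eigenvalues of the free rod `(-1, 1)` with tension `τ` that have an odd
eigenfunction (an odd function is nonzero exactly if it is nonconstant). -/
def oddEigenvalues (τ : ℝ) : Set ℝ :=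
  {μ | ∃ φ : ℝ → ℝ, SolvesRod 1 τ μ φ ∧ NonconstOn 1 φ ∧
    ∀ x ∈ Set.Icc (-1 : ℝ) 1, φ (-x) = -φ x}

/-- The `l`-th smallest element, `l = 0, 1, 2, …`, of a set of reals that is infinite, bounded
below and has no accumulation point: the least `x` such that at least `l + 1` elements of the
set are at most `x`. -/
noncomputable def nthSmallest (S : Set ℝ) (l : ℕ) : ℝ :=
  sInf {x : ℝ | ((l + 1 : ℕ) : ℕ∞) ≤ (S ∩ Set.Iic x).encard}

/-- The even eigenvalue branch `μ_l^even(τ)` of the free rod `(-1, 1)`. Within each parity class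
the eigenvalues are simple, so the branches of that class never cross and the `l`-th branch is
the `l`-th smallest eigenvalue of the class. -/
noncomputable def muEven (l : ℕ) (τ : ℝ) : ℝ := nthSmallest (evenEigenvalues τ) l

/-- The odd eigenvalue branch `μ_l^odd(τ)` of the free rod `(-1, 1)`. -/
noncomputable def muOdd (l : ℕ) (τ : ℝ) : ℝ := nthSmallest (oddEigenvalues τ) l

/-! ### Turing instability and the Turing space -/

/-- The derivative matrix of the kinetics at the steady state, as a complex matrix. -/
noncomputable def stabilityMatrix (p : Params) : Matrix (Fin 2) (Fin 2) ℂ :=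
  !![(p.fu : ℂ), (p.fv : ℂ); (p.gu : ℂ), (p.gv : ℂ)]

/-- Linear asymptotic stability of the steady state for the kinetics `u' = f(u,v)`,
`v' = g(u,v)`: all eigenvalues of the derivative matrix have negative real part. -/
def StableWithoutDiffusion (p : Params) : Prop :=
  ∀ z ∈ spectrum ℂ (stabilityMatrix p), z.re < 0

/-- Linear instability of the steady state when diffusion is present: the linearized system
`u_t = -(u'''' - τ u'') + f_u u + f_v v`, `v_t = -k (v'''' - τ v'') + g_u u + g_v v`
on `(-R, R)`, with free boundary conditions on `u` and `v`, has a nonzero separated solution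
`e^{zt} (u(x), v(x))` whose growth rate `z` has positive real part. -/
def UnstableWithDiffusion (R : ℝ) (p : Params) (τ : ℝ) : Prop :=
  ∃ (z : ℂ) (u v : ℝ → ℂ), 0 < z.re ∧
    ContDiff ℝ 4 u ∧ ContDiff ℝ 4 v ∧ FreeBC R τ u ∧ FreeBC R τ v ∧
    (∃ x ∈ Set.Ioo (-R) R, u x ≠ 0 ∨ v x ≠ 0) ∧
    ∀ x ∈ Set.Ioo (-R) R,
      z * u x = -rodOp τ u x + p.fu * u x + p.fv * v x ∧
      z * v x = p.k * -rodOp τ v x + p.gu * u x + p.gv * v x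

/-- The Turing space of the domain `(-R, R)`. -/
def turingSpaceDomain (R : ℝ) : Set (Params × ℝ) :=
  {q | StableWithoutDiffusion q.1 ∧ UnstableWithDiffusion R q.1 q.2}

/-- The Turing space of the domain `(-R, R)` with fixed tension `τ`. -/
def turingSpaceDomainTension (R τ : ℝ) : Set Params :=
  {p | (p, τ) ∈ turingSpaceDomain R}

/-- The Turing space `TS(p)` in the `(R, τ)`-plane with fixed reaction-diffusion parameters. -/
def TS (p : Params) : Set (ℝ × ℝ) :=
  {q | 0 < q.1 ∧ p ∈ turingSpaceDomainTension q.1 q.2}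

/-! ### Instability regions -/

noncomputable def Params.A (p : Params) : ℝ := (p.fu + p.gv) / (1 + p.k)

/-- The smaller root of `k μ² - (k f_u + g_v) μ + (f_u g_v - f_v g_u)`. -/
noncomputable def Params.a (p : Params) : ℝ :=
  ((p.k * p.fu + p.gv)
    - √((p.k * p.fu + p.gv) ^ 2 - 4 * p.k * (p.fu * p.gv - p.fv * p.gu))) / (2 * p.k)

/-- The larger root of `k μ² - (k f_u + g_v) μ + (f_u g_v - f_v g_u)`. -/
noncomputable def Params.b (p : Params) : ℝ :=
  ((p.k * p.fu + p.gv)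
    + √((p.k * p.fu + p.gv) ^ 2 - 4 * p.k * (p.fu * p.gv - p.fv * p.gu))) / (2 * p.k)

def EMinus (p : Params) (l : ℕ) : Set (ℝ × ℝ) :=
  {q | 0 < q.1 ∧ q.1 ^ (-4 : ℤ) * muEven l (q.2 * q.1 ^ 2) < p.A ∧ q.2 < 0}

def OMinus (p : Params) (l : ℕ) : Set (ℝ × ℝ) :=
  {q | 0 < q.1 ∧ q.1 ^ (-4 : ℤ) * muOdd l (q.2 * q.1 ^ 2) < p.A ∧ q.2 < 0}

def EPlus (p : Params) (l : ℕ) : Set (ℝ × ℝ) :=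
  {q | 0 < q.1 ∧ q.1 ^ (-4 : ℤ) * muEven l (q.2 * q.1 ^ 2) ∈ Set.Ioo p.a p.b}

def OPlus (p : Params) (l : ℕ) : Set (ℝ × ℝ) :=
  {q | 0 < q.1 ∧ q.1 ^ (-4 : ℤ) * muOdd l (q.2 * q.1 ^ 2) ∈ Set.Ioo p.a p.b}

def ERegion (p : Params) (l : ℕ) : Set (ℝ × ℝ) := EPlus p l ∪ EMinus p l

def ORegion (p : Params) (l : ℕ) : Set (ℝ × ℝ) := OPlus p l ∪ OMinus p l

def Cond1 (p : Params) : Prop := p.fu + p.gv < 0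

def Cond2 (p : Params) : Prop := 0 < p.fu * p.gv - p.fv * p.gu

def Cond3 (p : Params) : Prop :=
  0 < (p.k * p.fu + p.gv) ^ 2 - 4 * p.k * (p.fu * p.gv - p.fv * p.gu)

def Cond4 (p : Params) : Prop := 0 < p.k * p.fu + p.gv

end FreeRodTuring

namespace FreeRodTuring

/-! For a growing mode `e^{zt}(u, v)` the system says that the span of `u` and `v` is invariant
under the rod operator. An invariant space of dimension at most two contains an eigenvector, so one
rod eigenfunction appears directly, with no eigenfunction expansion; Green's identity makes its
eigenvalue `μ` real. Conversely, a rod eigenfunction times a kernel vector of the 2×2 matrix is a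
mode. Hence instability means that for some rod eigenvalue `μ` the quadratic `dispersion p z μ` in
`z` has a root in the right half plane. Its coefficients are real, so this happens exactly when the
linear one is negative, i.e. `μ < A`, or the constant one is, i.e. `a < μ < b`
(`unstableWithDiffusion_iff`, `quadratic_neg_iff`).

The value `μ = 0` satisfies neither condition, because `A < 0` and the constant coefficient at `0`
is the positive determinant. So constants, and the default value `0` of `nthSmallest`, do no harm.
Nonzero eigenvalues on `(-R, R)` rescale to `(-1, 1)`, split by parity, and are enumerated by the
branches because only finitely many lie below any level (`mem_rodEigenvalues_iff`). Finally `μ < A <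
0` forces `τ < 0` by the energy identity, which gives the sign condition in the minus regions. -/

lemma eqOn_Icc_of_eqOn_Ioo {F : Type*} [TopologicalSpace F] [T2Space F] {f g : ℝ → F}
    (hf : Continuous f) (hg : Continuous g) {R : ℝ} (hR : 0 < R)
    (h : ∀ x ∈ Set.Ioo (-R) R, f x = g x) : ∀ x ∈ Set.Icc (-R) R, f x = g x := by
  have := Set.EqOn.closure (s := Set.Ioo (-R) R) h hf hg
  rwa [closure_Ioo (by linarith)] at this

/-! ### The rod operator and free boundary conditions under linear maps, sums and scaling -/

section Operator

variable {F G : Type*} [NormedAddCommGroup F] [NormedSpace ℝ F]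
  [NormedAddCommGroup G] [NormedSpace ℝ G]

lemma iteratedDeriv_clm_comp {f : ℝ → F} (hf : ContDiff ℝ 4 f) (g : F →L[ℝ] G) {n : ℕ}
    (hn : n ≤ 4) (x : ℝ) :
    iteratedDeriv n (fun y => g (f y)) x = g (iteratedDeriv n f x) := by
  have h := g.iteratedFDeriv_comp_left (x := x) hf.contDiffAt (i := n) (by exact_mod_cast hn)
  have e : (fun y => g (f y)) = g ∘ f := rfl
  rw [iteratedDeriv_eq_iteratedFDeriv, e, h, iteratedDeriv_eq_iteratedFDeriv]
  rfl

lemma contDiff_of_four {f : ℝ → F} (hf : ContDiff ℝ 4 f) {n : ℕ} (hn : n ≤ 4) :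
    ContDiff ℝ n f :=
  hf.of_le (by exact_mod_cast hn)

lemma rodOp_clm_comp {f : ℝ → F} (hf : ContDiff ℝ 4 f) (g : F →L[ℝ] G) (τ x : ℝ) :
    rodOp τ (fun y => g (f y)) x = g (rodOp τ f x) := by
  simp only [rodOp, iteratedDeriv_clm_comp hf g (show 4 ≤ 4 by norm_num),
    iteratedDeriv_clm_comp hf g (show 2 ≤ 4 by norm_num), map_sub, map_smul]

lemma FreeBC.clm_comp {f : ℝ → F} {R τ : ℝ} (h : FreeBC R τ f) (hf : ContDiff ℝ 4 f)
    (g : F →L[ℝ] G) : FreeBC R τ (fun y => g (f y)) := by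
  intro x hx
  obtain ⟨h2, h3⟩ := h x hx
  rw [iteratedDeriv_clm_comp hf g (by norm_num), iteratedDeriv_clm_comp hf g (by norm_num),
    iteratedDeriv_clm_comp hf g (by norm_num), ← map_smul, ← map_sub, h2, h3, map_zero]
  exact ⟨rfl, rfl⟩

lemma rodOp_sum {ι : Type*} (s : Finset ι) {f : ι → ℝ → F} (hf : ∀ i ∈ s, ContDiff ℝ 4 (f i))
    (τ x : ℝ) : rodOp τ (fun y => ∑ i ∈ s, f i y) x = ∑ i ∈ s, rodOp τ (f i) x := by
  simp only [rodOp]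
  rw [iteratedDeriv_fun_sum fun i hi => (hf i hi).contDiffAt,
    iteratedDeriv_fun_sum fun i hi => (contDiff_of_four (hf i hi) (by norm_num)).contDiffAt,
    Finset.smul_sum, Finset.sum_sub_distrib]

lemma FreeBC.sum {ι : Type*} (s : Finset ι) {f : ι → ℝ → F} {R τ : ℝ}
    (h : ∀ i ∈ s, FreeBC R τ (f i)) (hf : ∀ i ∈ s, ContDiff ℝ 4 (f i)) :
    FreeBC R τ (fun y => ∑ i ∈ s, f i y) := by
  intro x hx
  rw [iteratedDeriv_fun_sum fun i hi => (contDiff_of_four (hf i hi) (n := 2) (by norm_num)).contDiffAt,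
    iteratedDeriv_fun_sum fun i hi => (contDiff_of_four (hf i hi) (n := 3) (by norm_num)).contDiffAt,
    iteratedDeriv_fun_sum fun i hi => (contDiff_of_four (hf i hi) (n := 1) (by norm_num)).contDiffAt,
    Finset.smul_sum, ← Finset.sum_sub_distrib]
  exact ⟨Finset.sum_eq_zero fun i hi => (h i hi x hx).1,
    Finset.sum_eq_zero fun i hi => (h i hi x hx).2⟩

lemma rodOp_add {f g : ℝ → F} (hf : ContDiff ℝ 4 f) (hg : ContDiff ℝ 4 g) (τ x : ℝ) :
    rodOp τ (fun y => f y + g y) x = rodOp τ f x + rodOp τ g x := by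
  simpa using rodOp_sum (Finset.univ : Finset (Fin 2)) (f := ![f, g])
    (fun i _ => by fin_cases i <;> assumption) τ x

lemma FreeBC.add {f g : ℝ → F} {R τ : ℝ} (h : FreeBC R τ f) (h' : FreeBC R τ g)
    (hf : ContDiff ℝ 4 f) (hg : ContDiff ℝ 4 g) : FreeBC R τ (fun y => f y + g y) := by
  simpa using FreeBC.sum (Finset.univ : Finset (Fin 2)) (f := ![f, g])
    (fun i _ => by fin_cases i <;> assumption) (fun i _ => by fin_cases i <;> assumption)

lemma rodOp_comp_mul {f : ℝ → F} (hf : ContDiff ℝ 4 f) (c τ x : ℝ) :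
    rodOp (τ * c ^ 2) (fun y => f (c * y)) x = c ^ 4 • rodOp τ f (c * x) := by
  simp only [rodOp]
  rw [iteratedDeriv_comp_const_smul hf,
    iteratedDeriv_comp_const_smul (contDiff_of_four hf (n := 2) (by norm_num))]
  module

lemma FreeBC.comp_mul {f : ℝ → F} {R τ : ℝ} (h : FreeBC R τ f) (hf : ContDiff ℝ 4 f) {c : ℝ}
    {S : ℝ} (hS : c * S = R ∨ c * S = -R) : FreeBC S (τ * c ^ 2) (fun y => f (c * y)) := by
  intro x hx
  have hx' : c * x = -R ∨ c * x = R := by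
    rcases hx with rfl | rfl <;> rcases hS with h | h <;> simp [h]
  obtain ⟨h2, h3⟩ := h _ hx'
  rw [iteratedDeriv_comp_const_smul (contDiff_of_four hf (n := 2) (by norm_num)),
    iteratedDeriv_comp_const_smul (contDiff_of_four hf (n := 3) (by norm_num)),
    iteratedDeriv_comp_const_smul (contDiff_of_four hf (n := 1) (by norm_num))]
  simp only [h2, smul_zero, true_and]
  rw [show c ^ 3 • iteratedDeriv 3 f (c * x) - (τ * c ^ 2) • c ^ 1 • iteratedDeriv 1 f (c * x)
    = c ^ 3 • (iteratedDeriv 3 f (c * x) - τ • iteratedDeriv 1 f (c * x)) by module, h3, smul_zero]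

lemma continuous_rodOp {f : ℝ → F} (hf : ContDiff ℝ 4 f) (τ : ℝ) : Continuous (rodOp τ f) :=
  (hf.continuous_iteratedDeriv 4 le_rfl).sub
    ((hf.continuous_iteratedDeriv 2 (by norm_num)).const_smul τ)

lemma rodOp_eq_zero_of_const {f : ℝ → F} {R τ : ℝ} {c : F}
    (h : ∀ x ∈ Set.Icc (-R) R, f x = c) : ∀ x ∈ Set.Ioo (-R) R, rodOp τ f x = 0 := by
  intro x hx
  have he : f =ᶠ[nhds x] fun _ => c := by
    filter_upwards [Ioo_mem_nhds hx.1 hx.2] with y hy using h y (Set.Ioo_subset_Icc_self hy)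
  simp [rodOp, he.iteratedDeriv_eq, iteratedDeriv_const]

lemma hasDerivAt_iteratedDeriv {f : ℝ → F} (hf : ContDiff ℝ 4 f) {n : ℕ} (hn : n < 4) (x : ℝ) :
    HasDerivAt (iteratedDeriv n f) (iteratedDeriv (n + 1) f x) x := by
  rw [iteratedDeriv_succ]
  exact (hf.differentiable_iteratedDeriv n (by exact_mod_cast hn) x).hasDerivAt

end Operator

/-! ### Green's identity and Poincaré inequalities -/

/-- Green's identity for the free rod. -/
lemma integral_rodOp_mul {f g : ℝ → ℝ} {R τ : ℝ} (hf : ContDiff ℝ 4 f) (hg : ContDiff ℝ 4 g)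
    (hbc : FreeBC R τ f) :
    ∫ x in (-R)..R, rodOp τ f x * g x =
      ∫ x in (-R)..R, (iteratedDeriv 2 f x * iteratedDeriv 2 g x
        + τ * (iteratedDeriv 1 f x * iteratedDeriv 1 g x)) := by
  have cf := fun n (hn : n ≤ 4) => hf.continuous_iteratedDeriv n (by exact_mod_cast hn)
  have cg := fun n (hn : n ≤ 4) => hg.continuous_iteratedDeriv n (by exact_mod_cast hn)
  have c0 := continuous_rodOp hf τ
  have f1 := cf 1 (by norm_num)
  have f2 := cf 2 (by norm_num)
  have g1 := cg 1 (by norm_num)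
  have g2 := cg 2 (by norm_num)
  have g0 := hg.continuous
  rw [← sub_eq_zero, ← intervalIntegral.integral_sub
    (Continuous.intervalIntegrable (by fun_prop) _ _) (Continuous.intervalIntegrable (by fun_prop) _ _)]
  -- This is the boundary term of two integrations by parts. The conditions on `f` alone make it
  -- vanish at both ends, so `g` needs none.
  have key : ∀ x ∈ Set.uIcc (-R) R, HasDerivAt
      (fun x => (iteratedDeriv 3 f x - τ * iteratedDeriv 1 f x) * g x
        - iteratedDeriv 2 f x * iteratedDeriv 1 g x)
      (rodOp τ f x * g x - (iteratedDeriv 2 f x * iteratedDeriv 2 g x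
        + τ * (iteratedDeriv 1 f x * iteratedDeriv 1 g x))) x := by
    intro x _
    have d0 : HasDerivAt g (iteratedDeriv 1 g x) x := by
      simpa using hasDerivAt_iteratedDeriv hg (n := 0) (by norm_num) x
    have := (((hasDerivAt_iteratedDeriv hf (n := 3) (by norm_num) x).sub
      ((hasDerivAt_iteratedDeriv hf (n := 1) (by norm_num) x).const_mul τ)).mul d0).sub
      ((hasDerivAt_iteratedDeriv hf (n := 2) (by norm_num) x).mul
        (hasDerivAt_iteratedDeriv hg (n := 1) (by norm_num) x))
    refine this.congr_deriv ?_
    simp only [rodOp, smul_eq_mul, Pi.sub_apply]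
    ring
  rw [intervalIntegral.integral_eq_sub_of_hasDerivAt key
    (Continuous.intervalIntegrable (by fun_prop) _ _)]
  obtain ⟨a2, a3⟩ := hbc R (Or.inr rfl)
  obtain ⟨b2, b3⟩ := hbc (-R) (Or.inl rfl)
  rw [smul_eq_mul] at a3 b3
  simp only [a2, a3, b2, b3]
  ring

lemma integral_rodOp_mul_comm {f g : ℝ → ℝ} {R τ : ℝ} (hf : ContDiff ℝ 4 f)
    (hg : ContDiff ℝ 4 g) (hbf : FreeBC R τ f) (hbg : FreeBC R τ g) :
    ∫ x in (-R)..R, rodOp τ f x * g x = ∫ x in (-R)..R, f x * rodOp τ g x := by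
  simp only [mul_comm (f _) (rodOp τ g _)]
  rw [integral_rodOp_mul hf hg hbf, integral_rodOp_mul hg hf hbg]
  simp only [mul_comm]

lemma integral_sq_pos {f : ℝ → ℝ} (hf : Continuous f) {R : ℝ} (hR : 0 < R)
    (h : ∃ x ∈ Set.Icc (-R) R, f x ≠ 0) : 0 < ∫ x in (-R)..R, f x ^ 2 := by
  obtain ⟨x, hx, hfx⟩ := h
  exact intervalIntegral.integral_pos (by linarith) (hf.pow 2).continuousOn
    (fun _ _ => sq_nonneg _) ⟨x, hx, by positivity⟩

/-- A Poincaré inequality for functions vanishing at the left endpoint. -/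
lemma integral_sq_le_of_left_eq_zero {f f' : ℝ → ℝ} {a b : ℝ} (hab : a < b)
    (hf : ∀ x, HasDerivAt f (f' x) x) (hc : Continuous f') (ha : f a = 0) :
    ∫ x in a..b, f x ^ 2 ≤ 4 * (b - a) ^ 2 * ∫ x in a..b, f' x ^ 2 := by
  have hcf : Continuous f := continuous_iff_continuousAt.2 fun x => (hf x).continuousAt
  have hh : 0 < b - a := sub_pos.2 hab
  -- With the weight `w = K(b - x)`, the product `f² w` vanishes at both ends, so its derivative
  -- integrates to zero. Completing the square leaves `(K - w²) f²`, and this `K` is chosen so that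
  -- `w² ≤ K/2`; the constant is then `2/K = 4(b - a)²`.
  set K := 1 / (2 * (b - a) ^ 2) with hK
  have hKpos : 0 < K := by positivity
  have hKh : K * (b - a) ^ 2 = 1 / 2 := by rw [hK]; field_simp
  have key : ∀ x ∈ Set.uIcc a b, HasDerivAt (fun x => f x ^ 2 * (K * (b - x)))
      (2 * f x * f' x * (K * (b - x)) - K * f x ^ 2) x := by
    intro x _
    refine (((hf x).pow 2).mul (((hasDerivAt_id x).const_sub b).const_mul K)).congr_deriv ?_
    simp
    ring
  have h0 := intervalIntegral.integral_eq_sub_of_hasDerivAt key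
    (Continuous.intervalIntegrable (by fun_prop) _ _)
  simp only [ha, sub_self] at h0
  have h1 : ∫ x in a..b, K / 2 * f x ^ 2 ≤
      ∫ x in a..b, (f' x ^ 2 - (2 * f x * f' x * (K * (b - x)) - K * f x ^ 2)) := by
    refine intervalIntegral.integral_mono_on hab.le
      (Continuous.intervalIntegrable (by fun_prop) _ _)
      (Continuous.intervalIntegrable (by fun_prop) _ _) fun x hx => ?_
    have h2 : (K * (b - x)) ^ 2 ≤ K / 2 := by
      have : (b - x) ^ 2 ≤ (b - a) ^ 2 :=
        pow_le_pow_left₀ (by linarith [hx.2]) (by linarith [hx.1]) 2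
      calc (K * (b - x)) ^ 2 = K * (K * (b - x) ^ 2) := by ring
        _ ≤ K * (K * (b - a) ^ 2) := by gcongr
        _ = K / 2 := by rw [hKh]; ring
    nlinarith [sq_nonneg (f' x - f x * (K * (b - x))), mul_le_mul_of_nonneg_left h2 (sq_nonneg (f x))]
  rw [intervalIntegral.integral_sub (Continuous.intervalIntegrable (by fun_prop) _ _)
    (Continuous.intervalIntegrable (by fun_prop) _ _), h0,
    intervalIntegral.integral_const_mul] at h1
  have h2 : ∫ x in a..b, f x ^ 2 = 4 * (b - a) ^ 2 * (K / 2 * ∫ x in a..b, f x ^ 2) := by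
    linear_combination (-2 * ∫ x in a..b, f x ^ 2) * hKh
  rw [h2]
  gcongr
  linarith

/-- The constant depends on the mesh, not on the length of the interval: the one-cell inequality is
summed over the cells, each using only the zero at its left end. -/
lemma integral_sq_le_of_grid_eq_zero {f f' : ℝ → ℝ} {a h : ℝ} (hh : 0 < h) (m : ℕ)
    (hf : ∀ x, HasDerivAt f (f' x) x) (hc : Continuous f')
    (hz : ∀ i < m, f (a + i * h) = 0) :
    ∫ x in a..(a + m * h), f x ^ 2 ≤ 4 * h ^ 2 * ∫ x in a..(a + m * h), f' x ^ 2 := by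
  have hcf : Continuous f := continuous_iff_continuousAt.2 fun x => (hf x).continuousAt
  have e1 := intervalIntegral.sum_integral_adjacent_intervals (a := fun i : ℕ => a + i * h)
    (f := fun x => f x ^ 2) (μ := MeasureTheory.volume) (n := m)
    fun k _ => (hcf.pow 2).intervalIntegrable _ _
  have e2 := intervalIntegral.sum_integral_adjacent_intervals (a := fun i : ℕ => a + i * h)
    (f := fun x => f' x ^ 2) (μ := MeasureTheory.volume) (n := m)
    fun k _ => (hc.pow 2).intervalIntegrable _ _
  simp only [Nat.cast_zero, zero_mul, add_zero] at e1 e2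
  rw [← e1, ← e2, Finset.mul_sum]
  refine Finset.sum_le_sum fun i hi => ?_
  have e3 : a + ((i + 1 : ℕ) : ℝ) * h - (a + i * h) = h := by push_cast; ring
  have := integral_sq_le_of_left_eq_zero (a := a + i * h) (b := a + ((i + 1 : ℕ) : ℝ) * h)
    (by linarith) hf hc (hz i (Finset.mem_range.1 hi))
  rwa [e3] at this


/-! ### Orthogonality and energy of eigenfunctions -/

lemma SolvesRod.eq_on_Icc {R τ μ : ℝ} {φ : ℝ → ℝ} (h : SolvesRod R τ μ φ) (hR : 0 < R) :
    ∀ x ∈ Set.Icc (-R) R, rodOp τ φ x = μ * φ x :=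
  eqOn_Icc_of_eqOn_Ioo (continuous_rodOp h.1 τ) (h.1.continuous.const_mul μ |>.congr fun _ => rfl)
    hR h.2.2

lemma SolvesRod.const_mul {R τ μ : ℝ} {φ : ℝ → ℝ} (h : SolvesRod R τ μ φ) (c : ℝ) :
    SolvesRod R τ μ (fun y => c * φ y) := by
  obtain ⟨h1, h2, h3⟩ := h
  refine ⟨contDiff_const.mul h1, h2.clm_comp h1 (ContinuousLinearMap.mul ℝ ℝ c), fun y hy => ?_⟩
  have := rodOp_clm_comp h1 (ContinuousLinearMap.mul ℝ ℝ c) τ y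
  simp only [ContinuousLinearMap.mul_apply'] at this
  rw [this, h3 y hy]
  ring

lemma SolvesRod.orthogonal {R τ μ ν : ℝ} {φ ψ : ℝ → ℝ} (h : SolvesRod R τ μ φ)
    (h' : SolvesRod R τ ν ψ) (hR : 0 < R) (hne : μ ≠ ν) : ∫ x in (-R)..R, φ x * ψ x = 0 := by
  have e := integral_rodOp_mul_comm h.1 h'.1 h.2.1 h'.2.1
  have hu : Set.uIcc (-R) R = Set.Icc (-R) R := Set.uIcc_of_le (by linarith)
  rw [intervalIntegral.integral_congr (g := fun x => μ * (φ x * ψ x)) fun x hx => by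
      simp only [h.eq_on_Icc hR x (hu ▸ hx)]; ring,
    intervalIntegral.integral_congr (g := fun x => ν * (φ x * ψ x)) (f := fun x => φ x * _)
      fun x hx => by simp only [h'.eq_on_Icc hR x (hu ▸ hx)]; ring,
    intervalIntegral.integral_const_mul, intervalIntegral.integral_const_mul] at e
  exact (mul_eq_mul_right_iff.1 e).resolve_left hne

lemma SolvesRod.energy {R τ μ : ℝ} {φ : ℝ → ℝ} (h : SolvesRod R τ μ φ) (hR : 0 < R) :
    ∫ x in (-R)..R, (iteratedDeriv 2 φ x ^ 2 + τ * iteratedDeriv 1 φ x ^ 2) =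
      μ * ∫ x in (-R)..R, φ x ^ 2 := by
  have e := integral_rodOp_mul h.1 h.1 h.2.1
  have hu : Set.uIcc (-R) R = Set.Icc (-R) R := Set.uIcc_of_le (by linarith)
  rw [intervalIntegral.integral_congr (g := fun x => μ * φ x ^ 2) fun x hx => by
      simp only [h.eq_on_Icc hR x (hu ▸ hx)]; ring, intervalIntegral.integral_const_mul] at e
  simp only [sq] at e ⊢
  exact e.symm

/-- Without compression the free rod has no negative eigenvalue. -/
lemma SolvesRod.tension_neg {R τ μ : ℝ} {φ : ℝ → ℝ} (h : SolvesRod R τ μ φ) (hR : 0 < R)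
    (hne : ∃ x ∈ Set.Icc (-R) R, φ x ≠ 0) (hμ : μ < 0) : τ < 0 := by
  by_contra! hτ
  have h0 := integral_sq_pos h.1.continuous hR hne
  have h1 : 0 ≤ ∫ x in (-R)..R, (iteratedDeriv 2 φ x ^ 2 + τ * iteratedDeriv 1 φ x ^ 2) :=
    intervalIntegral.integral_nonneg (by linarith) fun x _ => by positivity
  rw [h.energy hR] at h1
  nlinarith

/-! ### Discreteness of the spectrum -/

/-- A function vanishing to second order on a fine grid has large energy. -/
lemma integral_sq_nonpos_of_grid {f : ℝ → ℝ} (hf : ContDiff ℝ 4 f) {a h τ x : ℝ} (hh : 0 < h)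
    (m : ℕ) (hz : ∀ i < m, f (a + i * h) = 0) (hz' : ∀ i < m, iteratedDeriv 1 f (a + i * h) = 0)
    (hsmall : 4 * h ^ 2 * |τ| + (4 * h ^ 2) ^ 2 * |x| < 1)
    (he : ∫ y in a..(a + m * h), (iteratedDeriv 2 f y ^ 2 + τ * iteratedDeriv 1 f y ^ 2) ≤
      x * ∫ y in a..(a + m * h), f y ^ 2) :
    ∫ y in a..(a + m * h), f y ^ 2 ≤ 0 := by
  have c1 := hf.continuous_iteratedDeriv 1 (by norm_num)
  have c2 := hf.continuous_iteratedDeriv 2 (by norm_num)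
  have hle : a ≤ a + m * h := by have := mul_nonneg m.cast_nonneg hh.le; linarith
  have i1 := integral_sq_le_of_grid_eq_zero hh m
    (fun y => by simpa using hasDerivAt_iteratedDeriv hf (n := 0) (by norm_num) y) c1 hz
  have i2 := integral_sq_le_of_grid_eq_zero hh m
    (fun y => hasDerivAt_iteratedDeriv hf (n := 1) (by norm_num) y) c2 hz'
  rw [intervalIntegral.integral_add (Continuous.intervalIntegrable (by fun_prop) _ _)
    (Continuous.intervalIntegrable (by fun_prop) _ _), intervalIntegral.integral_const_mul] at he
  have p0 : 0 ≤ ∫ y in a..(a + m * h), f y ^ 2 :=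
    intervalIntegral.integral_nonneg hle fun _ _ => sq_nonneg _
  have p1 : 0 ≤ ∫ y in a..(a + m * h), iteratedDeriv 1 f y ^ 2 :=
    intervalIntegral.integral_nonneg hle fun _ _ => sq_nonneg _
  simp only [Nat.reduceAdd] at i2
  generalize (∫ y in a..(a + m * h), f y ^ 2) = I0 at *
  generalize (∫ y in a..(a + m * h), iteratedDeriv 1 f y ^ 2) = I1 at *
  generalize (∫ y in a..(a + m * h), iteratedDeriv 2 f y ^ 2) = I2 at *
  have hq : 0 < 4 * h ^ 2 := by positivity
  generalize 4 * h ^ 2 = q at *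
  have p2 : 0 ≤ I2 := by
    by_contra! hn
    nlinarith
  have i3 : I0 ≤ q ^ 2 * I2 := by
    calc I0 ≤ q * I1 := i1
      _ ≤ q * (q * I2) := by gcongr
      _ = q ^ 2 * I2 := by ring
  have a1 : x * I0 ≤ |x| * (q ^ 2 * I2) :=
    (mul_le_mul_of_nonneg_right (le_abs_self x) p0).trans (by gcongr)
  have a2 : -τ * I1 ≤ |τ| * (q * I2) :=
    (mul_le_mul_of_nonneg_right (neg_le_abs τ) p1).trans (by gcongr)
  -- Two uses of Poincaré bound everything by `I2`; `hsmall` makes the factor positive, so `I2` is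
  -- absorbed.
  have a3 : (1 - (q * |τ| + q ^ 2 * |x|)) * I2 ≤ 0 := by linarith
  have a4 : I2 ≤ 0 := by
    by_contra! hn
    nlinarith
  nlinarith [sq_nonneg q]

lemma exists_small_step (R τ x : ℝ) :
    ∃ m : ℕ, 0 < m ∧
      4 * (2 * R / m) ^ 2 * |τ| + (4 * (2 * R / m) ^ 2) ^ 2 * |x| < 1 := by
  have h : Filter.Tendsto (fun h : ℝ => 4 * h ^ 2 * |τ| + (4 * h ^ 2) ^ 2 * |x|) (nhds 0)
      (nhds 0) := by
    have hc : Continuous (fun h : ℝ => 4 * h ^ 2 * |τ| + (4 * h ^ 2) ^ 2 * |x|) := by fun_prop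
    simpa using hc.tendsto 0
  obtain ⟨m, hm, hm0⟩ := (((h.comp (tendsto_const_div_atTop_nhds_zero_nat (2 * R))).eventually
    (gt_mem_nhds one_pos)).and (Filter.eventually_gt_atTop 0)).exists
  exact ⟨m, hm0, hm⟩

/-- The eigenvalues of the free rod on `(-R, R)` with tension `τ`. -/
def rodEigenvalues (R τ : ℝ) : Set ℝ :=
  {μ | ∃ φ : ℝ → ℝ, SolvesRod R τ μ φ ∧ ∃ x ∈ Set.Icc (-R) R, φ x ≠ 0}

/-- The free rod has finitely many eigenvalues below any given level. -/
lemma finite_rodEigenvalues_inter_Iic {R : ℝ} (hR : 0 < R) (τ x : ℝ) :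
    (rodEigenvalues R τ ∩ Set.Iic x).Finite := by
  by_contra hinf
  obtain ⟨m, hm, hsmall⟩ := exists_small_step R τ x
  -- Prescribing value and slope at `m` grid points costs `2m` linear conditions, so `2m + 1`
  -- eigenfunctions have a nontrivial combination `ψ` that meets them with zero data.
  obtain ⟨T, hT, hcard⟩ := Set.Infinite.exists_subset_card_eq hinf (2 * m + 1)
  have hm' : (0 : ℝ) < m := by exact_mod_cast hm
  set h := 2 * R / m with hh
  have hpos : 0 < h := by positivity
  have hend : -R + m * h = R := by rw [hh]; field_simp; ring
  choose! φ hφ hne using fun μ (hμ : μ ∈ T) => (hT hμ).1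
  have hx : ∀ μ ∈ T, μ ≤ x := fun μ hμ => (hT hμ).2
  let A : (T → ℝ) →ₗ[ℝ] (Fin m ⊕ Fin m → ℝ) :=
    LinearMap.pi fun j => ∑ μ : T, (Sum.elim (fun i : Fin m => φ μ (-R + (i : ℕ) * h))
      (fun i : Fin m => iteratedDeriv 1 (φ μ) (-R + (i : ℕ) * h)) j) • LinearMap.proj μ
  have hker : A.ker ≠ ⊥ := LinearMap.ker_ne_bot_of_finrank_lt (by simp; omega)
  obtain ⟨c, hc, hc0⟩ := (Submodule.ne_bot_iff _).1 hker
  obtain ⟨μ₀, hμ₀⟩ := Function.ne_iff.1 hc0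
  let F : T → ℝ → ℝ := fun μ y => c μ * φ μ y
  have hF : ∀ μ : T, SolvesRod R τ μ (F μ) := fun μ => (hφ μ μ.2).const_mul (c μ)
  have hFc : ∀ μ : T, Continuous (F μ) := fun μ => (hF μ).1.continuous
  let ψ : ℝ → ℝ := fun y => ∑ μ : T, F μ y
  have hψ : ContDiff ℝ 4 ψ := ContDiff.sum fun μ _ => (hF μ).1
  have hψb : FreeBC R τ ψ := FreeBC.sum _ (fun μ _ => (hF μ).2.1) fun μ _ => (hF μ).1
  have hu : Set.uIcc (-R) R = Set.Icc (-R) R := Set.uIcc_of_le (by linarith)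
  have hdiag : ∀ w : T → ℝ, ∫ y in (-R)..R, (∑ μ : T, w μ * F μ y) * ψ y =
      ∑ μ : T, w μ * ∫ y in (-R)..R, F μ y ^ 2 := by
    intro w
    simp only [ψ, Finset.sum_mul, Finset.mul_sum]
    rw [intervalIntegral.integral_finsetSum fun μ _ =>
      Continuous.intervalIntegrable (by fun_prop) _ _]
    refine Finset.sum_congr rfl fun μ _ => ?_
    rw [intervalIntegral.integral_finsetSum fun ν _ =>
      Continuous.intervalIntegrable (by fun_prop) _ _, Finset.sum_eq_single μ]
    · rw [← intervalIntegral.integral_const_mul]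
      congr 1; ext y; ring
    · intro ν _ hν
      simp only [mul_assoc]
      rw [intervalIntegral.integral_const_mul, (hF ν).orthogonal (hF μ) hR
        (fun e => hν (Subtype.ext e)), mul_zero]
    · simp
  have hnn : ∀ μ : T, 0 ≤ ∫ y in (-R)..R, F μ y ^ 2 := fun μ =>
    intervalIntegral.integral_nonneg (by linarith) fun _ _ => sq_nonneg _
  have hsq : ∫ y in (-R)..R, ψ y ^ 2 = ∑ μ : T, ∫ y in (-R)..R, F μ y ^ 2 := by
    have := hdiag 1
    simp only [Pi.one_apply, one_mul] at this
    rw [← this]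
    simp only [ψ, sq]
  -- By orthogonality the energy of `ψ` is a sum of the squared norms of its components weighted by
  -- eigenvalues, all at most `x`. This contradicts the large energy forced by the grid zeros.
  have hen : ∫ y in (-R)..R, (iteratedDeriv 2 ψ y ^ 2 + τ * iteratedDeriv 1 ψ y ^ 2) ≤
      x * ∫ y in (-R)..R, ψ y ^ 2 := by
    have e := integral_rodOp_mul hψ hψ hψb
    simp only [← sq] at e
    rw [← e, intervalIntegral.integral_congr
      (g := fun y => (∑ μ : T, (μ : ℝ) * F μ y) * ψ y), hdiag fun μ => (μ : ℝ), hsq,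
      Finset.mul_sum]
    · exact Finset.sum_le_sum fun μ _ => mul_le_mul_of_nonneg_right (hx μ μ.2) (hnn μ)
    · intro y hy
      simp only [ψ]
      rw [rodOp_sum _ fun μ _ => (hF μ).1]
      congr 1
      exact Finset.sum_congr rfl fun μ _ => (hF μ).eq_on_Icc hR y (hu ▸ hy)
  have hA : ∀ j, A c j = 0 := fun j => congrFun hc j
  have hle := integral_sq_nonpos_of_grid (a := -R) (x := x) hψ hpos m (fun i hi => by
      have := hA (Sum.inl ⟨i, hi⟩)
      simp only [A, LinearMap.pi_apply, LinearMap.sum_apply, LinearMap.smul_apply,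
        LinearMap.proj_apply, Sum.elim_inl, smul_eq_mul] at this
      simp only [ψ, F, mul_comm (c _), this]) (fun i hi => by
      have := hA (Sum.inr ⟨i, hi⟩)
      simp only [A, LinearMap.pi_apply, LinearMap.sum_apply, LinearMap.smul_apply,
        LinearMap.proj_apply, Sum.elim_inr, smul_eq_mul] at this
      rw [iteratedDeriv_fun_sum fun μ _ =>
        (contDiff_of_four (hF μ).1 (n := 1) (by norm_num)).contDiffAt, ← this]
      refine Finset.sum_congr rfl fun μ _ => ?_
      rw [iteratedDeriv_const_mul _
        (contDiff_of_four (hφ μ μ.2).1 (n := 1) (by norm_num)).contDiffAt, mul_comm])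
    hsmall (by rw [hend]; exact hen)
  rw [hend, hsq] at hle
  have hpos0 : 0 < ∫ y in (-R)..R, F μ₀ y ^ 2 := by
    obtain ⟨y, hy, hy0⟩ := hne μ₀ μ₀.2
    exact integral_sq_pos (hFc μ₀) hR ⟨y, hy, mul_ne_zero hμ₀ hy0⟩
  have := Finset.single_le_sum (f := fun μ : T => ∫ y in (-R)..R, F μ y ^ 2)
    (fun μ _ => hnn μ) (Finset.mem_univ μ₀)
  linarith

/-! ### Enumeration of a discrete set bounded below -/

section NthSmallest

variable {S : Set ℝ}

lemma exists_nthSmallest_eq (hS : ∀ x, (S ∩ Set.Iic x).Finite) {μ : ℝ} (hμ : μ ∈ S) :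
    ∃ l, nthSmallest S l = μ := by
  have hmem : μ ∈ S ∩ Set.Iic μ := ⟨hμ, Set.self_mem_Iic⟩
  have hn : (S ∩ Set.Iic μ).ncard - 1 + 1 = (S ∩ Set.Iic μ).ncard :=
    Nat.sub_add_cancel ((Set.ncard_pos (hS μ)).2 ⟨μ, hmem⟩)
  -- Indices start at `0`, so the index of `μ` is the number of elements strictly below it.
  refine ⟨(S ∩ Set.Iic μ).ncard - 1, IsLeast.csInf_eq ⟨?_, fun x hx => ?_⟩⟩
  · rw [Set.mem_ofPred_eq, hn, (hS μ).cast_ncard_eq]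
  · rw [Set.mem_ofPred_eq, hn, ← (hS x).cast_ncard_eq, Nat.cast_le] at hx
    by_contra! hlt
    have hss : S ∩ Set.Iic x ⊂ S ∩ Set.Iic μ :=
      ⟨Set.inter_subset_inter_right _ (Set.Iic_subset_Iic.2 hlt.le),
        fun hsub => not_le.2 hlt (hsub hmem).2⟩
    exact absurd (Set.ncard_lt_ncard hss (hS μ)) (by omega)

/-- If `S` has at most `l` elements, the infimum is over the empty set and equals `0` by convention;
the hypothesis `h0` excludes this case. -/
lemma nthSmallest_mem (hS : ∀ x, (S ∩ Set.Iic x).Finite) {l : ℕ} (h0 : nthSmallest S l ≠ 0) :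
    nthSmallest S l ∈ S := by
  set X := {x : ℝ | ((l + 1 : ℕ) : ℕ∞) ≤ (S ∩ Set.Iic x).encard} with hX
  -- Lowering `x` to the largest element of `S` below it does not change the count, so the infimum
  -- may be sought within `S`, where it is attained by finiteness.
  have hstep : ∀ x ∈ X, ∃ y ∈ S ∩ X, y ≤ x := by
    intro x hx
    have hne : (S ∩ Set.Iic x).Nonempty := by
      rw [← Set.encard_pos]
      exact lt_of_lt_of_le (by simp) hx
    obtain ⟨y, ⟨hyS, hyx⟩, hy⟩ := (hS x).exists_maximalFor id _ hne
    have hsub : S ∩ Set.Iic x ⊆ S ∩ Set.Iic y := by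
      refine fun z hz => ⟨hz.1, ?_⟩
      by_contra hzy
      exact hzy (hy hz (not_le.1 hzy).le)
    exact ⟨y, ⟨hyS, le_trans hx (Set.encard_le_encard hsub)⟩, hyx⟩
  have hXne : X.Nonempty := by
    by_contra hne
    rw [Set.not_nonempty_iff_eq_empty] at hne
    exact h0 (by rw [nthSmallest, ← hX, hne, Real.sInf_empty])
  obtain ⟨x₀, hx₀⟩ := hXne
  obtain ⟨y₀, hy₀, hyx₀⟩ := hstep x₀ hx₀
  have hfin : (S ∩ X ∩ Set.Iic x₀).Finite :=
    (hS x₀).subset fun z hz => ⟨hz.1.1, hz.2⟩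
  obtain ⟨y, ⟨⟨hyS, hyX⟩, hyx⟩, hmin⟩ := hfin.exists_minimalFor id _ ⟨y₀, hy₀, hyx₀⟩
  have hleast : IsLeast X y := by
    refine ⟨hyX, fun x hx => ?_⟩
    obtain ⟨z, hz, hzx⟩ := hstep x hx
    by_contra! hlt
    have hzy : z < y := hzx.trans_lt hlt
    exact absurd (hmin ⟨hz, hzy.le.trans hyx⟩ hzy.le) (not_le.2 hzy)
  rw [nthSmallest, ← hX, hleast.csInf_eq]
  exact hyS

end NthSmallest


/-! ### Scaling, parity and the branches -/

lemma SolvesRod.comp_mul {R τ μ : ℝ} {φ : ℝ → ℝ} (h : SolvesRod R τ μ φ) {c S : ℝ} (hc : 0 < c)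
    (hS : c * S = R) : SolvesRod S (τ * c ^ 2) (c ^ 4 * μ) (fun y => φ (c * y)) := by
  obtain ⟨h1, h2, h3⟩ := h
  refine ⟨h1.comp (contDiff_const.mul contDiff_id), h2.comp_mul h1 (Or.inl hS), fun x hx => ?_⟩
  rw [rodOp_comp_mul h1, h3 (c * x) ⟨?_, ?_⟩, smul_eq_mul, mul_assoc]
  · rw [← hS, ← mul_neg]
    exact mul_lt_mul_of_pos_left hx.1 hc
  · rw [← hS]
    exact mul_lt_mul_of_pos_left hx.2 hc

lemma SolvesRod.comp_neg {R τ μ : ℝ} {φ : ℝ → ℝ} (h : SolvesRod R τ μ φ) :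
    SolvesRod R τ μ (fun y => φ (-y)) := by
  obtain ⟨h1, h2, h3⟩ := h
  have e1 := h2.comp_mul h1 (c := -1) (S := R) (Or.inr (by ring))
  have e2 := rodOp_comp_mul h1 (-1) τ
  simp only [neg_one_mul, even_two, Even.neg_pow, one_pow, mul_one] at e1 e2
  refine ⟨h1.comp contDiff_neg, e1, fun x hx => ?_⟩
  rw [e2, h3 (-x) ⟨by linarith [hx.2], by linarith [hx.1]⟩]
  norm_num

lemma SolvesRod.add {R τ μ : ℝ} {φ ψ : ℝ → ℝ} (h : SolvesRod R τ μ φ) (h' : SolvesRod R τ μ ψ) :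
    SolvesRod R τ μ (fun y => φ y + ψ y) :=
  ⟨h.1.add h'.1, h.2.1.add h'.2.1 h.1 h'.1, fun x hx => by
    rw [rodOp_add h.1 h'.1, h.2.2 x hx, h'.2.2 x hx, mul_add]⟩

lemma SolvesRod.nonconstOn {R τ μ : ℝ} {φ : ℝ → ℝ} (h : SolvesRod R τ μ φ) (hR : 0 < R)
    (hμ : μ ≠ 0) (hne : ∃ x ∈ Set.Icc (-R) R, φ x ≠ 0) : NonconstOn R φ := by
  by_contra hcon
  simp only [NonconstOn, not_exists, not_and, not_not] at hcon
  obtain ⟨x, hx, hx0⟩ := hne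
  have h0 : (0 : ℝ) ∈ Set.Ioo (-R) R := ⟨by linarith, hR⟩
  have h1 := rodOp_eq_zero_of_const (τ := τ)
    (fun y hy => hcon y hy 0 (Set.Ioo_subset_Icc_self h0)) 0 h0
  rw [h.2.2 0 h0, hcon 0 (Set.Ioo_subset_Icc_self h0) x hx] at h1
  exact mul_ne_zero hμ hx0 h1

lemma NonconstOn.exists_ne_zero {R : ℝ} {φ : ℝ → ℝ} (h : NonconstOn R φ) :
    ∃ x ∈ Set.Icc (-R) R, φ x ≠ 0 := by
  obtain ⟨x, hx, y, hy, hxy⟩ := h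
  by_contra! h0
  exact hxy (by rw [h0 x hx, h0 y hy])

lemma evenEigenvalues_subset (τ : ℝ) : evenEigenvalues τ ⊆ rodEigenvalues 1 τ :=
  fun _ ⟨φ, h, hn, _⟩ => ⟨φ, h, hn.exists_ne_zero⟩

lemma oddEigenvalues_subset (τ : ℝ) : oddEigenvalues τ ⊆ rodEigenvalues 1 τ :=
  fun _ ⟨φ, h, hn, _⟩ => ⟨φ, h, hn.exists_ne_zero⟩

/-- Every nonzero eigenvalue has a nonconstant even or a nonconstant odd eigenfunction. -/
lemma mem_even_or_odd {τ μ : ℝ} (hμ : μ ≠ 0) (h : μ ∈ rodEigenvalues 1 τ) :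
    μ ∈ evenEigenvalues τ ∨ μ ∈ oddEigenvalues τ := by
  obtain ⟨φ, hφ, x, hx, hx0⟩ := h
  -- If the even part vanishes at `x`, the odd part there is `φ x ≠ 0`, so one of the two is a
  -- nonzero eigenfunction.
  by_cases he : φ x + φ (-x) = 0
  · refine Or.inr ⟨_, hφ.add (hφ.comp_neg.const_mul (-1)),
      (hφ.add (hφ.comp_neg.const_mul (-1))).nonconstOn one_pos hμ ⟨x, hx, fun h0 => hx0 ?_⟩,
      fun y _ => ?_⟩
    · linarith
    · simp only [neg_neg]; ring
  · refine Or.inl ⟨_, hφ.add hφ.comp_neg, (hφ.add hφ.comp_neg).nonconstOn one_pos hμ ⟨x, hx, he⟩,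
      fun y _ => ?_⟩
    simp only [neg_neg]; ring

lemma mul_pow_mem_rodEigenvalues {R τ μ c S : ℝ} (hc : 0 < c) (hS : c * S = R)
    (h : μ ∈ rodEigenvalues R τ) : c ^ 4 * μ ∈ rodEigenvalues S (τ * c ^ 2) := by
  obtain ⟨φ, hφ, x, hx, hx0⟩ := h
  refine ⟨_, hφ.comp_mul hc hS, x / c, ⟨?_, ?_⟩, ?_⟩
  · rw [le_div_iff₀ hc]
    linarith [hx.1]
  · rw [div_le_iff₀ hc]
    linarith [hx.2]
  · rwa [mul_div_cancel₀ _ hc.ne']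

/-- The nonzero eigenvalues on `(-R, R)` are the nonzero values of the rescaled branches. -/
lemma mem_rodEigenvalues_iff {R τ μ : ℝ} (hR : 0 < R) (hμ : μ ≠ 0) :
    μ ∈ rodEigenvalues R τ ↔ ∃ l, R ^ (-4 : ℤ) * muEven l (τ * R ^ 2) = μ ∨
      R ^ (-4 : ℤ) * muOdd l (τ * R ^ 2) = μ := by
  have hz : R ^ (-4 : ℤ) * R ^ 4 = 1 := by
    rw [← zpow_natCast, ← zpow_add₀ hR.ne']; norm_num
  have hz0 : R ^ (-4 : ℤ) ≠ 0 := left_ne_zero_of_mul_eq_one hz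
  have hfe : ∀ x, (evenEigenvalues (τ * R ^ 2) ∩ Set.Iic x).Finite := fun x =>
    (finite_rodEigenvalues_inter_Iic one_pos _ x).subset
      (Set.inter_subset_inter_left _ (evenEigenvalues_subset _))
  have hfo : ∀ x, (oddEigenvalues (τ * R ^ 2) ∩ Set.Iic x).Finite := fun x =>
    (finite_rodEigenvalues_inter_Iic one_pos _ x).subset
      (Set.inter_subset_inter_left _ (oddEigenvalues_subset _))
  constructor
  · intro h
    have h1 := mul_pow_mem_rodEigenvalues (S := 1) hR (mul_one R) h
    have hs : R ^ (-4 : ℤ) * (R ^ 4 * μ) = μ := by rw [← mul_assoc, hz, one_mul]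
    rcases mem_even_or_odd (mul_ne_zero (by positivity) hμ) h1 with h2 | h2
    · obtain ⟨l, hl⟩ := exists_nthSmallest_eq hfe h2
      exact ⟨l, Or.inl (by rw [muEven, hl, hs])⟩
    · obtain ⟨l, hl⟩ := exists_nthSmallest_eq hfo h2
      exact ⟨l, Or.inr (by rw [muOdd, hl, hs])⟩
  · have back : ∀ ν ∈ rodEigenvalues 1 (τ * R ^ 2),
        R ^ (-4 : ℤ) * ν ∈ rodEigenvalues R τ := by
      intro ν hν
      have := mul_pow_mem_rodEigenvalues (inv_pos.2 hR) (inv_mul_cancel₀ hR.ne') hν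
      have e1 : R⁻¹ ^ 4 = R ^ (-4 : ℤ) := by
        rw [zpow_neg, inv_pow]; norm_cast
      have e2 : τ * R ^ 2 * R⁻¹ ^ 2 = τ := by field_simp
      rwa [e1, e2] at this
    rintro ⟨l, rfl | rfl⟩
    · exact back _ (evenEigenvalues_subset _ (nthSmallest_mem hfe (right_ne_zero_of_mul hμ)))
    · exact back _ (oddEigenvalues_subset _ (nthSmallest_mem hfo (right_ne_zero_of_mul hμ)))

/-! ### From modes of the system to rod eigenfunctions -/

/-- A complex eigenfunction has a real eigenvalue, with a real eigenfunction. -/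
lemma exists_real_of_complex_mode {R τ : ℝ} (hR : 0 < R) {φ : ℝ → ℂ} {μ : ℂ}
    (h1 : ContDiff ℝ 4 φ) (h2 : FreeBC R τ φ)
    (h3 : ∀ x ∈ Set.Ioo (-R) R, rodOp τ φ x = μ * φ x) (hne : ∃ x ∈ Set.Ioo (-R) R, φ x ≠ 0) :
    ∃ ν ∈ rodEigenvalues R τ, μ = (ν : ℂ) := by
  set f : ℝ → ℝ := fun x => Complex.reCLM (φ x)
  set g : ℝ → ℝ := fun x => Complex.imCLM (φ x)
  have hf : ContDiff ℝ 4 f := Complex.reCLM.contDiff.comp h1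
  have hg : ContDiff ℝ 4 g := Complex.imCLM.contDiff.comp h1
  have hfb : FreeBC R τ f := h2.clm_comp h1 _
  have hgb : FreeBC R τ g := h2.clm_comp h1 _
  have hφ : ∀ x ∈ Set.Icc (-R) R, rodOp τ φ x = μ * φ x := eqOn_Icc_of_eqOn_Ioo (continuous_rodOp h1 τ)
    (continuous_const.mul h1.continuous) hR h3
  have ef : ∀ x ∈ Set.Icc (-R) R, rodOp τ f x = μ.re * f x - μ.im * g x := fun x hx => by
    exact (rodOp_clm_comp h1 Complex.reCLM τ x).trans (by rw [hφ x hx]; exact Complex.mul_re _ _)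
  have eg : ∀ x ∈ Set.Icc (-R) R, rodOp τ g x = μ.re * g x + μ.im * f x := fun x hx => by
    exact (rodOp_clm_comp h1 Complex.imCLM τ x).trans (by rw [hφ x hx]; exact Complex.mul_im _ _)
  have hu : Set.uIcc (-R) R = Set.Icc (-R) R := Set.uIcc_of_le (by linarith)
  have cf := hf.continuous
  have cg := hg.continuous
  obtain ⟨x₀, hx₀, hφ₀⟩ := hne
  have hfg : f x₀ ≠ 0 ∨ g x₀ ≠ 0 := by
    by_contra! h
    exact hφ₀ (Complex.ext h.1 h.2)
  have hpos : 0 < ∫ x in (-R)..R, (f x ^ 2 + g x ^ 2) := by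
    refine intervalIntegral.integral_pos (by linarith) (by fun_prop) (fun _ _ => by positivity)
      ⟨x₀, Set.Ioo_subset_Icc_self hx₀, ?_⟩
    rcases hfg with h | h <;> positivity
  -- Symmetry of the operator, applied to the real and imaginary parts, gives `Im μ · ∫ |φ|² = 0`.
  have him : μ.im = 0 := by
    have e := integral_rodOp_mul_comm hf hg hfb hgb
    rw [intervalIntegral.integral_congr (g := fun x => μ.re * f x * g x - μ.im * g x ^ 2)
        fun x hx => by simp only [ef x (hu ▸ hx)]; ring,
      intervalIntegral.integral_congr (g := fun x => μ.re * f x * g x + μ.im * f x ^ 2)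
        (f := fun x => f x * _) fun x hx => by simp only [eg x (hu ▸ hx)]; ring,
      ← sub_eq_zero, ← intervalIntegral.integral_sub
        (Continuous.intervalIntegrable (by fun_prop) _ _)
        (Continuous.intervalIntegrable (by fun_prop) _ _),
      intervalIntegral.integral_congr (g := fun x => -μ.im * (f x ^ 2 + g x ^ 2))
        fun x _ => by simp only []; ring, intervalIntegral.integral_const_mul] at e
    simpa [hpos.ne'] using e
  refine ⟨μ.re, ?_, Complex.ext rfl (by simpa using him)⟩
  rcases hfg with h | h
  · exact ⟨f, ⟨hf, hfb, fun x hx => by simp [ef x (Set.Ioo_subset_Icc_self hx), him]⟩, x₀,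
      Set.Ioo_subset_Icc_self hx₀, h⟩
  · exact ⟨g, ⟨hg, hgb, fun x hx => by simp [eg x (Set.Ioo_subset_Icc_self hx), him]⟩, x₀,
      Set.Ioo_subset_Icc_self hx₀, h⟩

/-- The determinant of `M - z - μ D`, where `M` is the derivative matrix of the kinetics and
`D = diag(1, k)`. -/
noncomputable def dispersion (p : Params) (z μ : ℂ) : ℂ :=
  (p.fu - z - μ) * (p.gv - z - p.k * μ) - p.fv * p.gu

lemma UnstableWithDiffusion.exists_dispersion {R τ : ℝ} (hR : 0 < R) {p : Params}
    (hk : 0 < p.k) (h : UnstableWithDiffusion R p τ) :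
    ∃ μ ∈ rodEigenvalues R τ, ∃ z : ℂ, 0 < z.re ∧ dispersion p z μ = 0 := by
  obtain ⟨z, u, v, hz, hu, hv, hub, hvb, hne, heq⟩ := h
  have hk0 : (p.k : ℂ) ≠ 0 := by exact_mod_cast hk.ne'
  have eu : ∀ x ∈ Set.Ioo (-R) R, rodOp τ u x = (p.fu - z) * u x + p.fv * v x := fun x hx => by
    linear_combination (heq x hx).1
  have ev : ∀ x ∈ Set.Ioo (-R) R, p.k * rodOp τ v x = p.gu * u x + (p.gv - z) * v x :=
    fun x hx => by linear_combination (heq x hx).2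
  suffices ∃ (φ : ℝ → ℂ) (μ : ℂ), ContDiff ℝ 4 φ ∧ FreeBC R τ φ ∧
      (∀ x ∈ Set.Ioo (-R) R, rodOp τ φ x = μ * φ x) ∧ (∃ x ∈ Set.Ioo (-R) R, φ x ≠ 0) ∧
      dispersion p z μ = 0 by
    obtain ⟨φ, μ, h1, h2, h3, h4, h5⟩ := this
    obtain ⟨ν, hν, rfl⟩ := exists_real_of_complex_mode hR h1 h2 h3 h4
    exact ⟨ν, hν, z, hz, h5⟩
  -- Here the system is triangular: either `u` is an eigenfunction, or `u` vanishes and `v` is one.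
  by_cases hfv : (p.fv : ℂ) = 0
  · by_cases hu0 : ∃ x ∈ Set.Ioo (-R) R, u x ≠ 0
    · exact ⟨u, p.fu - z, hu, hub, fun x hx => by rw [eu x hx, hfv]; ring, hu0, by
        simp [dispersion, hfv]⟩
    · push Not at hu0
      refine ⟨v, (p.gv - z) / p.k, hv, hvb, fun x hx => ?_, ?_, ?_⟩
      · refine mul_left_cancel₀ hk0 ?_
        rw [ev x hx, hu0 x hx]
        field_simp
        ring
      · obtain ⟨x, hx, h⟩ := hne
        exact ⟨x, hx, h.resolve_left fun h => h (hu0 x hx)⟩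
      · simp only [dispersion, hfv]
        field_simp
        ring
  · -- the trace `s` and determinant `d` of the matrix of `rodOp` on the span of `u` and `v`
    set s : ℂ := p.fu - z + (p.gv - z) / p.k with hs
    set d : ℂ := ((p.fu - z) * (p.gv - z) - p.fv * p.gu) / p.k with hd
    obtain ⟨w, hw⟩ := IsAlgClosed.exists_pow_nat_eq (s ^ 2 - 4 * d) (n := 2) two_pos
    have hkd : p.k * d = (p.fu - z) * (p.gv - z) - p.fv * p.gu := by rw [hd]; field_simp
    have hks : p.k * s = p.k * (p.fu - z) + (p.gv - z) := by rw [hs]; field_simp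
    have hdisp : ∀ μ : ℂ, dispersion p z μ = p.k * (μ ^ 2 - s * μ + d) := fun μ => by
      rw [dispersion]
      linear_combination μ * hks - hkd
    set μ₁ := (s + w) / 2 with hμ₁
    set μ₂ := (s - w) / 2 with hμ₂
    have r1 : dispersion p z μ₁ = 0 := by
      rw [hdisp, hμ₁]
      linear_combination p.k / 4 * hw
    have r2 : dispersion p z μ₂ = 0 := by
      rw [hdisp, hμ₂]
      linear_combination p.k / 4 * hw
    have r12 : μ₁ + μ₂ = s := by rw [hμ₁, hμ₂]; ring
    -- The row `(c, fv)` is a left eigenvector for `μ₁` of the matrix of `rodOp` on `(u, v)`, so `φ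
    -- = c u + fv v` is an eigenfunction unless it vanishes. If it does, `v` can be eliminated and
    -- `u` has the other eigenvalue `μ₂ = s - μ₁`.
    set c : ℂ := μ₁ - (p.gv - z) / p.k with hc
    have hkc : p.k * c = p.k * μ₁ - (p.gv - z) := by rw [hc]; field_simp
    let φ : ℝ → ℂ := fun x => ContinuousLinearMap.mul ℝ ℂ c (u x)
      + ContinuousLinearMap.mul ℝ ℂ p.fv (v x)
    have cu : ContDiff ℝ 4 fun x => ContinuousLinearMap.mul ℝ ℂ c (u x) :=
      (ContinuousLinearMap.mul ℝ ℂ c).contDiff.comp hu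
    have cv : ContDiff ℝ 4 fun x => ContinuousLinearMap.mul ℝ ℂ p.fv (v x) :=
      (ContinuousLinearMap.mul ℝ ℂ p.fv).contDiff.comp hv
    by_cases hφ : ∃ x ∈ Set.Ioo (-R) R, φ x ≠ 0
    · refine ⟨φ, μ₁, cu.add cv, (hub.clm_comp hu _).add (hvb.clm_comp hv _) cu cv,
        fun x hx => ?_, hφ, r1⟩
      simp only [φ]
      rw [rodOp_add cu cv, rodOp_clm_comp hu, rodOp_clm_comp hv]
      simp only [ContinuousLinearMap.mul_apply']
      refine mul_left_cancel₀ hk0 ?_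
      rw [dispersion] at r1
      linear_combination p.k * c * eu x hx + p.fv * ev x hx
        + ((p.fu - z - μ₁) * u x + p.fv * v x) * hkc - u x * r1
    · push Not at hφ
      have hφ' : ∀ x ∈ Set.Ioo (-R) R, c * u x + p.fv * v x = 0 := hφ
      refine ⟨u, μ₂, hu, hub, fun x hx => ?_, ?_, r2⟩
      · rw [eu x hx]
        linear_combination hφ' x hx - u x * r12 + u x * hs - u x * hc
      · by_contra! hu0
        obtain ⟨x, hx, h⟩ := hne
        refine h.elim (fun h => h (hu0 x hx)) fun h => h ?_
        simpa [hu0 x hx, hfv] using hφ' x hx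

lemma unstableWithDiffusion_of_dispersion {R τ μ : ℝ} (hR : 0 < R) {p : Params}
    (hμ : μ ∈ rodEigenvalues R τ) {z : ℂ} (hz : 0 < z.re) (hd : dispersion p z μ = 0) :
    UnstableWithDiffusion R p τ := by
  obtain ⟨φ, ⟨h1, h2, h3⟩, hne⟩ := hμ
  have hdet : Matrix.det !![(p.fu - z - μ : ℂ), p.fv; p.gu, p.gv - z - p.k * μ] = 0 := by
    rw [Matrix.det_fin_two_of, ← hd, dispersion]
  obtain ⟨r, hr0, hr⟩ := Matrix.exists_mulVec_eq_zero_iff.2 hdet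
  have e0 := congrFun hr 0
  have e1 := congrFun hr 1
  simp only [Matrix.mulVec, dotProduct, Fin.sum_univ_two, Matrix.of_apply, Matrix.cons_val',
    Matrix.cons_val_zero, Matrix.cons_val_one, Matrix.cons_val_fin_one, Pi.zero_apply] at e0 e1
  have hs : ∀ i, ContDiff ℝ 4 fun x => ContinuousLinearMap.toSpanSingleton ℝ (r i) (φ x) :=
    fun i => (ContinuousLinearMap.toSpanSingleton ℝ (r i)).contDiff.comp h1
  refine ⟨z, fun x => ContinuousLinearMap.toSpanSingleton ℝ (r 0) (φ x),
    fun x => ContinuousLinearMap.toSpanSingleton ℝ (r 1) (φ x), hz, hs 0, hs 1,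
    h2.clm_comp h1 _, h2.clm_comp h1 _, ?_, fun x hx => ?_⟩
  · by_contra! hcon
    have hφ0 : ∀ x ∈ Set.Ioo (-R) R, φ x = 0 := by
      intro x hx
      by_contra hx0
      obtain ⟨c0, c1⟩ := hcon x hx
      simp only [ContinuousLinearMap.toSpanSingleton_apply, smul_eq_zero, hx0, false_or] at c0 c1
      exact hr0 (by ext i; fin_cases i <;> assumption)
    obtain ⟨y, hy, hy0⟩ := hne
    exact hy0 (eqOn_Icc_of_eqOn_Ioo h1.continuous continuous_const hR hφ0 y hy)
  · rw [rodOp_clm_comp h1, rodOp_clm_comp h1, h3 x hx]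
    simp only [ContinuousLinearMap.toSpanSingleton_apply, Complex.real_smul, Complex.ofReal_mul]
    constructor
    · linear_combination -φ x * e0
    · linear_combination -φ x * e1

/-! ### Signs of the dispersion relation and stability -/

/-- A real quadratic has a root with positive real part iff its linear or its constant
coefficient is negative. -/
lemma exists_root_re_pos_iff (B C : ℝ) :
    (∃ z : ℂ, 0 < z.re ∧ z ^ 2 + B * z + C = 0) ↔ B < 0 ∨ C < 0 := by
  constructor
  · rintro ⟨z, hz, h⟩
    by_contra! hBC
    have hre := congrArg Complex.re h
    have him := congrArg Complex.im h
    simp [sq] at hre him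
    have hy : z.im = 0 := by
      -- The imaginary part of the equation shows that a root with `Re z > 0` is real when `B ≥ 0`.
      have : z.im * (2 * z.re + B) = 0 := by linarith
      exact (mul_eq_zero.1 this).resolve_right (by linarith [hBC.1])
    rw [hy] at hre
    nlinarith [mul_nonneg hBC.1 hz.le, hBC.2]
  · intro h
    rcases le_or_gt 0 (B ^ 2 - 4 * C) with hD | hD
    · refine ⟨((-B + √(B ^ 2 - 4 * C)) / 2 : ℝ), ?_, ?_⟩
      · rw [Complex.ofReal_re]
        have h0 := Real.sqrt_nonneg (B ^ 2 - 4 * C)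
        rcases lt_or_ge B 0 with hB | hB
        · linarith
        · have := Real.lt_sqrt_of_sq_lt (x := B) (y := B ^ 2 - 4 * C)
            (by linarith [h.resolve_left (not_lt.2 hB)])
          linarith
      · have := Real.sq_sqrt hD
        norm_cast
        linear_combination this / 4
    · have hB : B < 0 := h.resolve_right (by nlinarith [sq_nonneg B])
      refine ⟨⟨-B / 2, √(4 * C - B ^ 2) / 2⟩, by simpa using hB, ?_⟩
      have := Real.sq_sqrt (show 0 ≤ 4 * C - B ^ 2 by linarith)
      apply Complex.ext
      · simp only [sq, Complex.add_re, Complex.mul_re, Complex.ofReal_re,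
          Complex.ofReal_im, Complex.zero_re] at this ⊢
        linear_combination -this / 4
      · simp [sq]
        ring

lemma unstableWithDiffusion_iff {R τ : ℝ} (hR : 0 < R) {p : Params} (hk : 0 < p.k) :
    UnstableWithDiffusion R p τ ↔ ∃ μ ∈ rodEigenvalues R τ, μ < p.A ∨
      p.k * μ ^ 2 - (p.k * p.fu + p.gv) * μ + (p.fu * p.gv - p.fv * p.gu) < 0 := by
  have key : ∀ μ : ℝ, (∃ z : ℂ, 0 < z.re ∧ dispersion p z μ = 0) ↔ μ < p.A ∨
      p.k * μ ^ 2 - (p.k * p.fu + p.gv) * μ + (p.fu * p.gv - p.fv * p.gu) < 0 := by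
    intro μ
    have hA : μ < p.A ↔ (1 + p.k) * μ - (p.fu + p.gv) < 0 := by
      rw [Params.A, lt_div_iff₀ (by linarith), sub_neg, mul_comm]
    rw [hA, ← exists_root_re_pos_iff]
    refine exists_congr fun z => and_congr_right fun _ => ?_
    rw [dispersion]
    push_cast
    ring_nf
  constructor
  · intro h
    obtain ⟨μ, hμ, hz⟩ := h.exists_dispersion hR hk
    exact ⟨μ, hμ, (key μ).1 hz⟩
  · rintro ⟨μ, hμ, h⟩
    obtain ⟨z, hz, hd⟩ := (key μ).2 h
    exact unstableWithDiffusion_of_dispersion hR hμ hz hd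

lemma stableWithoutDiffusion {p : Params} (h1 : Cond1 p) (h2 : Cond2 p) :
    StableWithoutDiffusion p := by
  intro z hz
  rw [spectrum.mem_iff, Matrix.isUnit_iff_isUnit_det, isUnit_iff_ne_zero, not_not,
    Matrix.det_fin_two] at hz
  simp [stabilityMatrix, Matrix.algebraMap_matrix_apply] at hz
  rw [Cond1] at h1
  rw [Cond2] at h2
  have hre := congrArg Complex.re hz
  have him := congrArg Complex.im hz
  simp at hre him
  by_contra! hz0
  have hy : z.im = 0 := by
    have : z.im * (2 * z.re - (p.fu + p.gv)) = 0 := by linarith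
    exact (mul_eq_zero.1 this).resolve_right (by linarith)
  rw [hy] at hre
  nlinarith [mul_nonneg hz0 hz0]

/-- Multiplication by `4k` completes the square, turning the sign condition into `|2kμ - (k f_u +
g_v)| < s`, with `s` the root of the discriminant. -/
lemma quadratic_neg_iff {p : Params} (hk : 0 < p.k) (h3 : Cond3 p) (μ : ℝ) :
    p.k * μ ^ 2 - (p.k * p.fu + p.gv) * μ + (p.fu * p.gv - p.fv * p.gu) < 0 ↔
      μ ∈ Set.Ioo p.a p.b := by
  rw [Cond3] at h3
  have hs := Real.sq_sqrt h3.le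
  have hs0 := Real.sqrt_nonneg
    ((p.k * p.fu + p.gv) ^ 2 - 4 * p.k * (p.fu * p.gv - p.fv * p.gu))
  rw [Set.mem_Ioo, Params.a, Params.b, div_lt_iff₀ (by linarith), lt_div_iff₀ (by linarith)]
  generalize √((p.k * p.fu + p.gv) ^ 2 - 4 * p.k * (p.fu * p.gv - p.fv * p.gu)) = s at *
  have hfac : 4 * p.k * (p.k * μ ^ 2 - (p.k * p.fu + p.gv) * μ
      + (p.fu * p.gv - p.fv * p.gu)) =
      (μ * (2 * p.k) - (p.k * p.fu + p.gv)) ^ 2 - s ^ 2 := by rw [hs]; ring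
  have h4k : 0 < 4 * p.k := by linarith
  rw [← mul_lt_mul_iff_right₀ h4k, mul_zero, hfac, sub_neg, sq_lt_sq, abs_of_nonneg hs0, abs_lt]
  constructor <;> rintro ⟨h, h'⟩ <;> constructor <;> linarith

/-! ### The Turing space in terms of the branches -/

lemma mem_TS_iff {p : Params} (hk : 0 < p.k) (h1 : Cond1 p) (h2 : Cond2 p) (q : ℝ × ℝ) :
    q ∈ TS p ↔ 0 < q.1 ∧ ∃ l, ∃ μ, (μ = q.1 ^ (-4 : ℤ) * muEven l (q.2 * q.1 ^ 2) ∨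
      μ = q.1 ^ (-4 : ℤ) * muOdd l (q.2 * q.1 ^ 2)) ∧ (μ < p.A ∧ q.2 < 0 ∨
      p.k * μ ^ 2 - (p.k * p.fu + p.gv) * μ + (p.fu * p.gv - p.fv * p.gu) < 0) := by
  have hA : p.A < 0 := div_neg_of_neg_of_pos h1 (by linarith)
  have hT : q ∈ TS p ↔ 0 < q.1 ∧ UnstableWithDiffusion q.1 p q.2 :=
    and_congr_right fun _ => and_iff_right (stableWithoutDiffusion h1 h2)
  have hne : ∀ μ, (μ < p.A ∨
      p.k * μ ^ 2 - (p.k * p.fu + p.gv) * μ + (p.fu * p.gv - p.fv * p.gu) < 0) → μ ≠ 0 := by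
    rintro μ h rfl
    rw [Cond2] at h2
    rcases h with h | h
    · linarith
    · linarith
  rw [hT]
  refine and_congr_right fun hR => ?_
  rw [unstableWithDiffusion_iff hR hk]
  constructor
  · rintro ⟨μ, hμ, h⟩
    obtain ⟨l, hl⟩ := (mem_rodEigenvalues_iff hR (hne μ h)).1 hμ
    -- The extra condition `q.2 < 0` comes for free: a negative eigenvalue requires compression.
    refine ⟨l, μ, hl.imp Eq.symm Eq.symm, h.imp_left fun h => ⟨h, ?_⟩⟩
    obtain ⟨φ, hφ, hφ0⟩ := hμ
    exact hφ.tension_neg hR hφ0 (h.trans hA)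
  · rintro ⟨l, μ, hl, h⟩
    have h' := h.imp_left And.left
    exact ⟨μ, (mem_rodEigenvalues_iff hR (hne μ h')).2 ⟨l, hl.imp Eq.symm Eq.symm⟩, h'⟩

end FreeRodTuring

theorem theorem3p3 (p : FreeRodTuring.Params) (hk : 0 < p.k) :
    (FreeRodTuring.Cond1 p → FreeRodTuring.Cond2 p →
      FreeRodTuring.Cond3 p → FreeRodTuring.Cond4 p →
        FreeRodTuring.TS p =
          ⋃ l : ℕ, (FreeRodTuring.ERegion p l ∪ FreeRodTuring.ORegion p l)) ∧
    (FreeRodTuring.Cond1 p → FreeRodTuring.Cond2 p →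
      ∀ l : ℕ, FreeRodTuring.EMinus p l ∪ FreeRodTuring.OMinus p l ⊆ FreeRodTuring.TS p) := by
  open FreeRodTuring in
  refine ⟨fun h1 h2 h3 _ => ?_, fun h1 h2 l q hq => ?_⟩
  · ext q
    rw [mem_TS_iff hk h1 h2]
    simp only [quadratic_neg_iff hk h3, Set.mem_iUnion, Set.mem_union, ERegion, ORegion, EPlus,
      EMinus, OPlus, OMinus, Set.mem_ofPred_eq]
    constructor
    · rintro ⟨hR, l, μ, rfl | rfl, h | h⟩ <;> exact ⟨l, by tauto⟩
    · rintro ⟨l, (⟨hR, h⟩ | ⟨hR, h⟩) | (⟨hR, h⟩ | ⟨hR, h⟩)⟩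
      · exact ⟨hR, l, _, Or.inl rfl, Or.inr h⟩
      · exact ⟨hR, l, _, Or.inl rfl, Or.inl h⟩
      · exact ⟨hR, l, _, Or.inr rfl, Or.inr h⟩
      · exact ⟨hR, l, _, Or.inr rfl, Or.inl h⟩
  · rw [mem_TS_iff hk h1 h2]
    rcases hq with ⟨hR, h⟩ | ⟨hR, h⟩
    · exact ⟨hR, l, _, Or.inl rfl, Or.inl h⟩
    · exact ⟨hR, l, _, Or.inr rfl, Or.inl h⟩
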